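/- A random walk labeling of a connected undirected graph $G$ with finitely many vertices is a labeling of its vertices obtained as follows: start a walk at an arbitrary vertex and give it the label $1$; as long as there are unlabeled vertices, move to an adjacent vertex, and, whenever the vertex reached is not yet labeled, give it the next label $2,3,\dots$. Let $\mathcal{L}(G)$ denote the number of different random walk labelings of $G$. Let $m\ge 3$ and $n\ge 0$ be integers, put $t=m-1$, and let $S_{m,n}$ be the snake graph obtained from the path graph $P_{n+1}$ on $n+1$ vertices by replacing each edge of the path with an edge of a (separate) copy of the cycle graph $C_m$. Let $b_{m,n}$ denote the number of random walk labelings of $S_{m,n}$ that start at a given one of the ends of the path (this number is the same for both ends). Then $$b_{m,n}=\begin{cases}1,&n=0;\\ 2^{m-2},&n=1;\\ b_{m,n-1}\left(1+\sum_{j=2}^{t}\binom{nt+1-j}{m-j}2^{t-j}\right),&n>1,\end{cases}$$ and \begin{align*} \mathcal{L}(S_{m,n})&=\sum_{k=0}^{n-1}\sum_{j=2}^{t}\sum_{r=0}^{t-j-1}\sum_{s=0}^{kt}\binom{r+s}{s}\binom{nt-s-j-r}{kt-s,\;t-j-r,\;(n-1-k)t}2^{t-r-2}\,b_{m,k}\,b_{m,n-1-k}\\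 &\quad+\sum_{k=0}^{n-1}\sum_{j=2}^{t}2^{j-1}\sum_{s=0}^{kt}\binom{t-j+s}{s}\binom{(n-1)t-s}{kt-s}\,b_{m,k}\,b_{m,n-1-k}\\ &\quad+\sum_{k=0}^{n}\binom{nt}{kt}\,b_{m,k}\,b_{m,n-k}, \end{align*} where empty sums are $0$ and $\binom{a+b+c}{a,b,c}=\frac{(a+b+c)!}{a!\,b!\,c!}$ is the multinomial coefficient. -/

import Mathlib

/-- `WalkState G v i ℓ` says that the random walk labeling process on `G` can be in the state in
which the walker stands at `v`, the last label used is `i`, and `ℓ` is the labeling produced so far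
(`ℓ x = 0` means that `x` is not labeled yet; the labels are `1, 2, 3, …`). -/
inductive WalkState {V : Type*} [DecidableEq V] (G : SimpleGraph V) : V → ℕ → (V → ℕ) → Prop
  /-- Choose any vertex and label it with `1`. -/
  | start (v : V) : WalkState G v 1 (Function.update (fun _ => 0) v 1)
  /-- As long as there are unlabeled vertices, move to a neighbor; here it is already labeled. -/
  | moveOld {v w : V} {i : ℕ} {ℓ : V → ℕ} (h : WalkState G v i ℓ) (hx : ∃ x, ℓ x = 0)
      (hvw : G.Adj v w) (hw : ℓ w ≠ 0) : WalkState G w i ℓ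
  /-- As long as there are unlabeled vertices, move to a neighbor; here it is not yet labeled, so
  it receives the next label. -/
  | moveNew {v w : V} {i : ℕ} {ℓ : V → ℕ} (h : WalkState G v i ℓ)
      (hvw : G.Adj v w) (hw : ℓ w = 0) : WalkState G w (i + 1) (Function.update ℓ w (i + 1))

/-- A random walk labeling of `G`: a labeling of all the vertices that the process can produce. -/
def IsRandomWalkLabeling {V : Type*} [DecidableEq V] (G : SimpleGraph V) (ℓ : V → ℕ) : Prop :=
  (∃ v i, WalkState G v i ℓ) ∧ ∀ x, ℓ x ≠ 0

/-- The number `𝓛(G)` of random walk labelings of `G`. -/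
noncomputable def numLabelings {V : Type*} [DecidableEq V] (G : SimpleGraph V) : ℕ :=
  Set.ncard {ℓ : V → ℕ | IsRandomWalkLabeling G ℓ}

/-- The number of random walk labelings of `G` that start at the vertex `v`. -/
noncomputable def numLabelingsFrom {V : Type*} [DecidableEq V] (G : SimpleGraph V) (v : V) : ℕ :=
  Set.ncard {ℓ : V → ℕ | IsRandomWalkLabeling G ℓ ∧ ℓ v = 1}

/-- The snake graph `S_{m,n}`. With `t = m - 1`, its vertices are `0, 1, …, n * t`; the vertices of
the path `P_{n+1}` are the multiples `0, t, 2 * t, …, n * t` of `t`. For `k < n` the edge of the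
path between `k * t` and `(k + 1) * t` is replaced by a copy of the cycle graph `C_m` on the
vertices `k * t, k * t + 1, …, k * t + t`, one of whose edges joins `k * t` and
`(k + 1) * t` (the vertices `0` and `m - 1` of `C_m`). -/
def snakeGraph (m n : ℕ) : SimpleGraph (Fin (n * (m - 1) + 1)) where
  Adj u v := ∃ k < n, ∃ a b : Fin m, (SimpleGraph.cycleGraph m).Adj a b ∧
    (u : ℕ) = k * (m - 1) + a ∧ (v : ℕ) = k * (m - 1) + b
  symm := ⟨by
    rintro u v ⟨k, hk, a, b, hab, hu, hv⟩
    exact ⟨k, hk, b, a, hab.symm, hv, hu⟩⟩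
  loopless := ⟨by
    rintro u ⟨k, -, a, b, hab, hu, hv⟩
    have h : a = b := Fin.ext (by omega)
    exact hab.ne h⟩

/-- `b_{m,n}`: the number of random walk labelings of `S_{m,n}` that start at the end `0` of the
path `P_{n+1}`. -/
noncomputable def endLabelings (m n : ℕ) : ℕ := numLabelingsFrom (snakeGraph m n) 0

/-!
The labels of a random walk labeling order the vertices so that each one but the first is adjacent to
an earlier one, and every such ordering arises, since the walker can return to any labeled vertex
through labeled vertices (`WalkState.move`). So the problem is to count these orderings.
`orderingCount G S A` counts the orderings of `A` in which every vertex is adjacent to `S` or to an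
earlier vertex; it is determined by summing over the first vertex, and two facts carry the argument:

* it depends only on the graph induced on `A` and on which vertices of `A` have a neighbor in `S`
  (`orderingCount_image`), so that snakes may be translated, reflected, and cut at the vertices of
  the path;
* if there are no edges between `A` and `B`, the orderings of `A ∪ B` are the shuffles of those of
  `A` and `B` (`orderingCount_union`), which is where the binomial coefficients come from.

All snakes are placed in one infinite snake graph on `ℤ`, whose path consists of the multiples of
`t`. A walk that starts at the end `0` of the path passes through the first cycle from `1` upwards
until it takes the edge from `0` to the exit `t`; from then on, the missing arc of the cycle (filled
in from both ends, `orderingCount_arc`) and the shorter snake behind `t` are shuffled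
(`orderingCount_tail`). This gives the recursion.

For a start at a vertex of the path, the two halves of the snake are shuffled
(`orderingCount_pathVertex`). For a start inside a cycle, the visited arc grows on either side until
it contains one of the two exits `0` and `t` (`sum_diagonal`); by reflection it may be taken to be
`0`, and then the snake on the left of `0` is shuffled with the rest, which is the situation of
`orderingCount_tail` again (`arcCount_zero`). The result has fewer summation variables than the
formula of the theorem, in which the number `s` of vertices visited on the left before the second
exit is recorded too; the sum over `s` is evaluated by the Vandermonde-like identity
`sum_choose_mul_choose`.
-/

/-! ### Counting growth orderings -/

section OrderingCount

variable {V W : Type*} [DecidableEq V] [DecidableEq W]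

open Classical in
/-- Auxiliary recursion for `orderingCount`; the first argument is the number of vertices that are
still to be placed. -/
noncomputable def orderingCountAux (G : SimpleGraph V) : ℕ → Set V → Finset V → ℕ
  | 0, _, _ => 1
  | n + 1, S, A => ∑ x ∈ A with ∃ y ∈ S, G.Adj y x, orderingCountAux G n (insert x S) (A.erase x)

/-- The number of orderings of the finite set `A` in which every vertex is adjacent to a vertex of
`S` or to an earlier vertex of `A`. It is meant for `A` disjoint from `S`. -/
noncomputable def orderingCount (G : SimpleGraph V) (S : Set V) (A : Finset V) : ℕ :=
  orderingCountAux G A.card S A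

@[simp]
theorem orderingCount_empty (G : SimpleGraph V) (S : Set V) : orderingCount G S ∅ = 1 := rfl

theorem orderingCount_eq_sum (G : SimpleGraph V) (S : Set V)
    [DecidablePred fun x => ∃ y ∈ S, G.Adj y x] {A : Finset V} (hA : A.Nonempty) :
    orderingCount G S A =
      ∑ x ∈ A with ∃ y ∈ S, G.Adj y x, orderingCount G (insert x S) (A.erase x) := by
  obtain ⟨n, hn⟩ := Nat.exists_eq_succ_of_ne_zero hA.card_pos.ne'
  rw [orderingCount, hn, orderingCountAux]
  refine Finset.sum_congr (Finset.filter_congr_decidable ..) fun x hx => ?_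
  rw [orderingCount, Finset.card_erase_of_mem (Finset.mem_filter.1 hx).1, hn]
  rfl

/-- The first vertex of an ordering when there is only one candidate. -/
theorem orderingCount_of_unique (G : SimpleGraph V) (S : Set V) {A : Finset V} {x : V}
    (hx : x ∈ A) (h : ∀ z ∈ A, (∃ y ∈ S, G.Adj y z) ↔ z = x) :
    orderingCount G S A = orderingCount G (insert x S) (A.erase x) := by
  classical
  rw [orderingCount_eq_sum G S ⟨x, hx⟩]
  have : (A.filter fun z => ∃ y ∈ S, G.Adj y z) = {x} := by
    ext z
    simp only [Finset.mem_filter, Finset.mem_singleton]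
    exact ⟨fun hz => (h z hz.1).1 hz.2, fun hz => hz ▸ ⟨hx, (h x hx).2 rfl⟩⟩
  rw [this, Finset.sum_singleton]

/-- The first vertex of an ordering when there are exactly two candidates. -/
theorem orderingCount_of_pair (G : SimpleGraph V) (S : Set V) {A : Finset V} {x x' : V}
    (hx : x ∈ A) (hx' : x' ∈ A) (hne : x ≠ x')
    (h : ∀ z ∈ A, (∃ y ∈ S, G.Adj y z) ↔ z = x ∨ z = x') :
    orderingCount G S A = orderingCount G (insert x S) (A.erase x) +
      orderingCount G (insert x' S) (A.erase x') := by
  classical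
  rw [orderingCount_eq_sum G S ⟨x, hx⟩]
  have : (A.filter fun z => ∃ y ∈ S, G.Adj y z) = {x, x'} := by
    ext z
    simp only [Finset.mem_filter, Finset.mem_singleton, Finset.mem_insert]
    refine ⟨fun hz => (h z hz.1).1 hz.2, ?_⟩
    rintro (rfl | rfl)
    · exact ⟨hx, (h _ hx).2 (Or.inl rfl)⟩
    · exact ⟨hx', (h _ hx').2 (Or.inr rfl)⟩
  rw [this, Finset.sum_pair hne]

/-- The number of orderings depends only on the graph induced on `A` and on the set of vertices of
`A` that have a neighbor in `S`. -/
theorem orderingCount_image (G : SimpleGraph V) (H : SimpleGraph W) (φ : V → W) (S : Set V)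
    (T : Set W) (A : Finset V) (hφ : Set.InjOn φ A)
    (hS : ∀ x ∈ A, (∃ y ∈ S, G.Adj y x) ↔ ∃ y ∈ T, H.Adj y (φ x))
    (hA : ∀ x ∈ A, ∀ y ∈ A, G.Adj x y ↔ H.Adj (φ x) (φ y)) :
    orderingCount G S A = orderingCount H T (A.image φ) := by
  classical
  induction hn : A.card generalizing S T A with
  | zero => simp [Finset.card_eq_zero.1 hn]
  | succ n ih =>
    have hne : A.Nonempty := Finset.card_pos.1 (by omega)
    rw [orderingCount_eq_sum G S hne, orderingCount_eq_sum H T (hne.image φ)]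
    have hf : (A.image φ).filter (fun x => ∃ y ∈ T, H.Adj y x) =
        (A.filter fun x => ∃ y ∈ S, G.Adj y x).image φ := by
      ext z
      simp only [Finset.mem_filter, Finset.mem_image]
      constructor
      · rintro ⟨⟨x, hx, rfl⟩, h⟩
        exact ⟨x, ⟨hx, (hS x hx).2 h⟩, rfl⟩
      · rintro ⟨x, ⟨hx, h⟩, rfl⟩
        exact ⟨⟨x, hx, rfl⟩, (hS x hx).1 h⟩
    rw [hf, Finset.sum_image fun x hx y hy h => hφ (Finset.mem_filter.1 hx).1
      (Finset.mem_filter.1 hy).1 h]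
    refine Finset.sum_congr rfl fun x hx => ?_
    have hxA := (Finset.mem_filter.1 hx).1
    have him : (A.image φ).erase (φ x) = (A.erase x).image φ := by
      ext z
      simp only [Finset.mem_erase, Finset.mem_image]
      constructor
      · rintro ⟨hz, y, hy, rfl⟩
        exact ⟨y, ⟨fun h => hz (h ▸ rfl), hy⟩, rfl⟩
      · rintro ⟨y, ⟨hyx, hy⟩, rfl⟩
        exact ⟨fun h => hyx (hφ hy hxA h), y, hy, rfl⟩
    rw [him]
    refine ih _ _ _ (hφ.mono (by simp)) ?_ ?_ ?_
    · intro z hz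
      have hzA := Finset.mem_of_mem_erase hz
      simp only [Set.mem_insert_iff, exists_eq_or_imp, hS z hzA, hA x hxA z hzA]
    · exact fun y hy z hz => hA y (Finset.mem_of_mem_erase hy) z (Finset.mem_of_mem_erase hz)
    · rw [Finset.card_erase_of_mem hxA]; omega

theorem orderingCount_congr (G : SimpleGraph V) (S T : Set V) (A : Finset V)
    (h : ∀ x ∈ A, (∃ y ∈ S, G.Adj y x) ↔ ∃ y ∈ T, G.Adj y x) :
    orderingCount G S A = orderingCount G T A := by
  have := orderingCount_image G G id S T A (Set.injOn_id _) (by simpa using h) (by simp)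
  simpa using this

/-- If there are no edges between `A` and `B`, then the orderings of `A ∪ B` are the shuffles of
an ordering of `A` and an ordering of `B`. -/
theorem orderingCount_union (G : SimpleGraph V) (S : Set V) (A B : Finset V)
    (hd : Disjoint A B) (hAB : ∀ x ∈ A, ∀ y ∈ B, ¬ G.Adj x y) :
    orderingCount G S (A ∪ B) =
      (A.card + B.card).choose A.card * orderingCount G S A * orderingCount G S B := by
  classical
  induction hn : A.card + B.card generalizing S A B with
  | zero =>
    have hA : A = ∅ := Finset.card_eq_zero.1 (by omega)
    have hB : B = ∅ := Finset.card_eq_zero.1 (by omega)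
    simp [hA, hB]
  | succ n ih =>
    rcases A.eq_empty_or_nonempty with rfl | hA
    · simp
    rcases B.eq_empty_or_nonempty with rfl | hB
    · have : A.card = n + 1 := by simpa using hn
      simp [this]
    have hfd : Disjoint (A.filter fun x => ∃ y ∈ S, G.Adj y x)
        (B.filter fun x => ∃ y ∈ S, G.Adj y x) := Finset.disjoint_filter_filter hd
    rw [orderingCount_eq_sum G S (hA.mono Finset.subset_union_left), Finset.filter_union,
      Finset.sum_union hfd]
    obtain ⟨a, ha⟩ := Nat.exists_eq_succ_of_ne_zero hA.card_pos.ne'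
    obtain ⟨b, hb⟩ := Nat.exists_eq_succ_of_ne_zero hB.card_pos.ne'
    have h1 : ∑ x ∈ A with ∃ y ∈ S, G.Adj y x,
          orderingCount G (insert x S) ((A ∪ B).erase x) =
        n.choose a * orderingCount G S A * orderingCount G S B := by
      rw [orderingCount_eq_sum G S hA, Finset.mul_sum, Finset.sum_mul]
      refine Finset.sum_congr rfl fun x hx => ?_
      have hxA := (Finset.mem_filter.1 hx).1
      have hxB := Finset.disjoint_left.1 hd hxA
      have hc := Finset.card_erase_of_mem hxA
      rw [Finset.erase_union_distrib, Finset.erase_eq_of_notMem hxB,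
        ih _ _ _ (hd.mono_left (Finset.erase_subset _ _))
          (fun y hy => hAB y (Finset.mem_of_mem_erase hy)) (by omega), hc, ha,
        orderingCount_congr G (insert x S) S B]
      · simp
      · intro z hz
        simp [hAB x hxA z hz]
    have h2 : ∑ x ∈ B with ∃ y ∈ S, G.Adj y x,
          orderingCount G (insert x S) ((A ∪ B).erase x) =
        n.choose (a + 1) * orderingCount G S A * orderingCount G S B := by
      rw [orderingCount_eq_sum G S hB, Finset.mul_sum]
      refine Finset.sum_congr rfl fun x hx => ?_
      have hxB := (Finset.mem_filter.1 hx).1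
      have hxA := Finset.disjoint_right.1 hd hxB
      have hc := Finset.card_erase_of_mem hxB
      rw [Finset.erase_union_distrib, Finset.erase_eq_of_notMem hxA,
        ih _ _ _ (hd.mono_right (Finset.erase_subset _ _))
          (fun y hy z hz => hAB y hy z (Finset.mem_of_mem_erase hz)) (by omega), ha,
        orderingCount_congr G (insert x S) S A]
      · intro z hz
        simp [show ¬ G.Adj x z from fun h => hAB z hz x hxB h.symm]
    rw [h1, h2, ha, Nat.choose_succ_succ]
    ring

end OrderingCount

/-! ### Random walk labelings as growth orderings -/

section Labelings

variable {V : Type*} [DecidableEq V]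

/-- The partial labeling `ℓ` uses each of the labels `1, …, i` exactly once, and every vertex
whose label exceeds `1` has a neighbor with a smaller (nonzero) label. -/
structure IsGrowthLabeling (G : SimpleGraph V) (i : ℕ) (ℓ : V → ℕ) : Prop where
  le : ∀ x, ℓ x ≤ i
  surj : ∀ j, 1 ≤ j → j ≤ i → ∃ x, ℓ x = j
  inj : ∀ x y, ℓ x ≠ 0 → ℓ x = ℓ y → x = y
  adj : ∀ x, 1 < ℓ x → ∃ y, G.Adj y x ∧ ℓ y ≠ 0 ∧ ℓ y < ℓ x

theorem isGrowthLabeling_single (G : SimpleGraph V) (v : V) :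
    IsGrowthLabeling G 1 (Function.update (fun _ => 0) v 1) where
  le x := by
    by_cases h : x = v <;> simp [h]
  surj j h1 h2 := ⟨v, by simp; omega⟩
  inj x y hx hxy := by
    by_cases h : x = v <;> by_cases h' : y = v <;> simp_all
  adj x hx := by
    by_cases h : x = v <;> simp [h] at hx

theorem IsGrowthLabeling.update {G : SimpleGraph V} {i : ℕ} {ℓ : V → ℕ}
    (h : IsGrowthLabeling G i ℓ) {v w : V} (hv : ℓ v ≠ 0) (hvw : G.Adj v w) (hw : ℓ w = 0) :
    IsGrowthLabeling G (i + 1) (Function.update ℓ w (i + 1)) where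
  le x := by
    have := h.le x
    by_cases hx : x = w
    · simp [hx]
    · simp only [Function.update_of_ne hx]; omega
  surj j h1 h2 := by
    rcases Nat.lt_or_ge i j with hj | hj
    · exact ⟨w, by simp; omega⟩
    · obtain ⟨x, hx⟩ := h.surj j h1 hj
      refine ⟨x, ?_⟩
      rw [Function.update_of_ne (by rintro rfl; omega), hx]
  inj x y hx hxy := by
    have h1 := h.le x
    have h2 := h.le y
    by_cases hxw : x = w <;> by_cases hyw : y = w
    · rw [hxw, hyw]
    · simp only [hxw, Function.update_self, Function.update_of_ne hyw] at hxy; omega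
    · simp only [hyw, Function.update_self, Function.update_of_ne hxw] at hxy; omega
    · simp only [Function.update_of_ne hxw, Function.update_of_ne hyw] at hx hxy
      exact h.inj x y hx hxy
  adj x hx := by
    by_cases hxw : x = w
    · have := h.le v
      refine ⟨v, hxw ▸ hvw, ?_⟩
      rw [Function.update_of_ne (by rintro rfl; exact hv hw), hxw, Function.update_self]
      exact ⟨hv, by omega⟩
    · rw [Function.update_of_ne hxw] at hx ⊢
      obtain ⟨y, hy, hy0, hyx⟩ := h.adj x hx
      refine ⟨y, hy, ?_⟩
      rw [Function.update_of_ne (by rintro rfl; exact hy0 hw)]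
      exact ⟨hy0, hyx⟩

/-- Removing the largest label. -/
theorem IsGrowthLabeling.erase {G : SimpleGraph V} {i : ℕ} {ℓ : V → ℕ}
    (h : IsGrowthLabeling G (i + 1) ℓ) {w : V} (hw : ℓ w = i + 1) :
    IsGrowthLabeling G i (Function.update ℓ w 0) where
  le x := by
    by_cases hx : x = w
    · simp [hx]
    · have h1 := h.le x
      have h2 : ℓ x ≠ i + 1 := fun h' => hx (h.inj x w (by omega) (h'.trans hw.symm))
      rw [Function.update_of_ne hx]; omega
  surj j h1 h2 := by
    obtain ⟨x, hx⟩ := h.surj j h1 (by omega)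
    refine ⟨x, ?_⟩
    rw [Function.update_of_ne (by rintro rfl; omega), hx]
  inj x y hx hxy := by
    by_cases hxw : x = w
    · simp [hxw] at hx
    by_cases hyw : y = w
    · simp only [Function.update_of_ne hxw] at hx
      simp [Function.update_of_ne hxw, hyw, hx] at hxy
    simp only [Function.update_of_ne hxw, Function.update_of_ne hyw] at hx hxy
    exact h.inj x y hx hxy
  adj x hx := by
    by_cases hxw : x = w
    · simp [hxw] at hx
    · rw [Function.update_of_ne hxw] at hx ⊢
      obtain ⟨y, hy, hy0, hyx⟩ := h.adj x hx
      have := h.le x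
      refine ⟨y, hy, ?_⟩
      rw [Function.update_of_ne (by rintro rfl; omega)]
      exact ⟨hy0, hyx⟩

theorem WalkState.isGrowthLabeling {G : SimpleGraph V} {v : V} {i : ℕ} {ℓ : V → ℕ}
    (h : WalkState G v i ℓ) : IsGrowthLabeling G i ℓ ∧ ℓ v ≠ 0 := by
  induction h with
  | start v => exact ⟨isGrowthLabeling_single G v, by simp⟩
  | moveOld _ _ _ hw ih => exact ⟨ih.1, hw⟩
  | moveNew _ hvw hw ih => exact ⟨ih.1.update ih.2 hvw hw, by simp⟩

/-- As long as there are unlabeled vertices, the walker can go to any labeled vertex, passing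
through labeled vertices only: descend along smaller and smaller labels to the vertex with label
`1`, and climb up from there. -/
theorem WalkState.move {G : SimpleGraph V} {v w : V} {i : ℕ} {ℓ : V → ℕ}
    (h : WalkState G v i ℓ) (hx : ∃ x, ℓ x = 0) (hw : ℓ w ≠ 0) : WalkState G w i ℓ := by
  obtain ⟨hg, hv⟩ := h.isGrowthLabeling
  have down : ∀ n v, ℓ v = n + 1 → WalkState G v i ℓ → ∃ r, ℓ r = 1 ∧ WalkState G r i ℓ := by
    intro n
    induction n using Nat.strong_induction_on with
    | _ n ih =>
      intro v hv h
      rcases Nat.eq_zero_or_pos n with rfl | hn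
      · exact ⟨v, hv, h⟩
      · obtain ⟨y, hy, hy0, hyv⟩ := hg.adj v (by omega)
        exact ih (ℓ y - 1) (by omega) y (by omega) (h.moveOld hx hy.symm hy0)
  obtain ⟨r, hr, hrs⟩ := down (ℓ v - 1) v (by omega) h
  have up : ∀ n w, ℓ w = n + 1 → WalkState G w i ℓ := by
    intro n
    induction n using Nat.strong_induction_on with
    | _ n ih =>
      intro w hw
      rcases Nat.eq_zero_or_pos n with rfl | hn
      · rwa [hg.inj w r (by omega) (hw.trans hr.symm)]
      · obtain ⟨y, hy, hy0, hyw⟩ := hg.adj w (by omega)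
        exact (ih (ℓ y - 1) (by omega) y (by omega)).moveOld hx hy (by omega)
  exact up (ℓ w - 1) w (by omega)

/-- Every growth labeling is produced by a walk: before each new label the walker goes back to a
labeled neighbor of the vertex that is to be labeled next. -/
theorem IsGrowthLabeling.exists_walkState {G : SimpleGraph V} {i : ℕ} {ℓ : V → ℕ}
    (h : IsGrowthLabeling G (i + 1) ℓ) : ∃ v, WalkState G v (i + 1) ℓ := by
  induction i generalizing ℓ with
  | zero =>
    obtain ⟨v, hv⟩ := h.surj 1 le_rfl le_rfl
    refine ⟨v, ?_⟩
    have : ℓ = Function.update (fun _ => 0) v 1 := by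
      funext x
      by_cases hx : x = v
      · simp [hx, hv]
      · have h1 := h.le x
        have h2 : ℓ x ≠ 1 := fun h' => hx (h.inj x v (by omega) (h'.trans hv.symm))
        rw [Function.update_of_ne hx]; omega
    rw [this]
    exact .start v
  | succ i ih =>
    obtain ⟨w, hw⟩ := h.surj (i + 1 + 1) (by omega) le_rfl
    obtain ⟨v, hv⟩ := ih (h.erase hw)
    obtain ⟨y, hy, hy0, hyw⟩ := h.adj w (by omega)
    have hyw' : y ≠ w := by rintro rfl; omega
    have hs := (hv.move (w := y) ⟨w, by simp⟩ (by rwa [Function.update_of_ne hyw'])).moveNew hy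
      (by simp)
    refine ⟨w, ?_⟩
    rwa [Function.update_idem, ← hw, Function.update_eq_self, hw] at hs

theorem isRandomWalkLabeling_iff [Nonempty V] (G : SimpleGraph V) (ℓ : V → ℕ) :
    IsRandomWalkLabeling G ℓ ↔ (∃ i, IsGrowthLabeling G i ℓ) ∧ ∀ x, ℓ x ≠ 0 := by
  refine and_congr_left fun h0 => ⟨fun ⟨v, i, h⟩ => ⟨i, h.isGrowthLabeling.1⟩, fun ⟨i, h⟩ => ?_⟩
  obtain ⟨x⟩ := ‹Nonempty V›
  have h1 := h.le x
  have h2 := h0 x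
  obtain ⟨i, rfl⟩ := Nat.exists_eq_succ_of_ne_zero (show i ≠ 0 by omega)
  obtain ⟨v, hv⟩ := h.exists_walkState
  exact ⟨v, _, hv⟩

theorem encard_biUnion_finset {α ι : Type*} (s : Finset ι) (f : ι → Set α)
    (h : (s : Set ι).PairwiseDisjoint f) : (⋃ i ∈ s, f i).encard = ∑ i ∈ s, (f i).encard := by
  rw [← finsum_mem_coe_finset, ← Set.Finite.encard_biUnion s.finite_toSet h]
  simp

variable [Fintype V]

/-- The growth labelings of the whole graph that continue the partial labeling `ℓ` with largest
label `i`. -/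
def completions (G : SimpleGraph V) (i : ℕ) (ℓ : V → ℕ) : Set (V → ℕ) :=
  {ℓ' | (∃ N, IsGrowthLabeling G N ℓ') ∧ (∀ x, ℓ' x ≠ 0) ∧
    ∀ x, (ℓ x ≠ 0 → ℓ' x = ℓ x) ∧ (ℓ x = 0 → i < ℓ' x)}

/-- Completions of a partial labeling are classified by the vertex that gets the next label, which
is the recursion for `orderingCount`. The cardinality is taken in `ℕ∞`, so that finiteness need not be
carried along. -/
theorem completions_encard (G : SimpleGraph V) (i : ℕ) (ℓ : V → ℕ) (h : IsGrowthLabeling G i ℓ)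
    (hi : 1 ≤ i) :
    (completions G i ℓ).encard =
      orderingCount G {x | ℓ x ≠ 0} (Finset.univ.filter fun x => ℓ x = 0) := by
  classical
  induction hn : (Finset.univ.filter fun x => ℓ x = 0).card generalizing i ℓ with
  | zero =>
    have hA := Finset.card_eq_zero.1 hn
    have h0 : ∀ x, ℓ x ≠ 0 := by simpa [Finset.filter_eq_empty_iff] using hA
    have : completions G i ℓ = {ℓ} := by
      ext ℓ'
      simp only [completions, Set.mem_ofPred_eq, Set.mem_singleton_iff]
      constructor
      · rintro ⟨-, -, h'⟩
        exact funext fun x => (h' x).1 (h0 x)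
      · rintro rfl
        exact ⟨⟨i, h⟩, h0, fun x => ⟨fun _ => rfl, fun hx => absurd hx (h0 x)⟩⟩
    simp [this, hA]
  | succ n ih =>
    have hne : (Finset.univ.filter fun x => ℓ x = 0).Nonempty := Finset.card_pos.1 (by omega)
    set A := Finset.univ.filter fun x => ℓ x = 0 with hA
    set F := A.filter fun x => ∃ y ∈ {x | ℓ x ≠ 0}, G.Adj y x with hF
    have hmem : ∀ x ∈ F, ℓ x = 0 ∧ ∃ y, ℓ y ≠ 0 ∧ G.Adj y x := by
      intro x hx
      simpa [hF, hA] using hx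
    have hU : completions G i ℓ =
        ⋃ x ∈ F, completions G (i + 1) (Function.update ℓ x (i + 1)) := by
      ext ℓ'
      simp only [Set.mem_iUnion, exists_prop]
      constructor
      · rintro ⟨⟨N, hN⟩, h0, h'⟩
        obtain ⟨z, hz⟩ := hne
        have hz0 : ℓ z = 0 := by simpa [hA] using hz
        have hiN : i + 1 ≤ N := ((h' z).2 hz0).trans_le (hN.le z)
        obtain ⟨x, hx⟩ := hN.surj (i + 1) (by omega) hiN
        have hx0 : ℓ x = 0 := by
          by_contra hx0
          have := (h' x).1 hx0
          have := h.le x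
          omega
        refine ⟨x, ?_, ⟨N, hN⟩, h0, fun y => ?_⟩
        · obtain ⟨y, hy, hy0, hyx⟩ := hN.adj x (by omega)
          simp only [hF, hA, Finset.mem_filter, Finset.mem_univ, true_and, Set.mem_ofPred_eq]
          refine ⟨hx0, y, fun hy' => ?_, hy⟩
          have := (h' y).2 hy'
          omega
        · by_cases hyx : y = x
          · subst hyx
            simp [hx]
          · rw [Function.update_of_ne hyx]
            refine ⟨(h' y).1, fun hy0 => ?_⟩
            have h1 := (h' y).2 hy0
            have h2 : ℓ' y ≠ i + 1 := fun he => hyx (hN.inj y x (h0 y) (he.trans hx.symm))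
            omega
      · rintro ⟨x, hx, hN, h0, h'⟩
        have hx0 := (hmem x hx).1
        refine ⟨hN, h0, fun y => ?_⟩
        by_cases hyx : y = x
        · subst hyx
          have := (h' y).1 (by simp)
          simp only [Function.update_self] at this
          exact ⟨fun h => absurd hx0 h, fun _ => by omega⟩
        · have := h' y
          rw [Function.update_of_ne hyx] at this
          exact ⟨this.1, fun hy => by have := this.2 hy; omega⟩
    have hdis : (F : Set V).PairwiseDisjoint
        fun x => completions G (i + 1) (Function.update ℓ x (i + 1)) := by
      intro x hx y hy hxy
      refine Set.disjoint_left.2 fun ℓ' ⟨⟨N, hN⟩, h0, h'⟩ ⟨_, _, h''⟩ => hxy ?_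
      have h1 := (h' x).1 (by simp)
      have h2 := (h'' y).1 (by simp)
      simp only [Function.update_self] at h1 h2
      exact hN.inj x y (h0 x) (h1.trans h2.symm)
    rw [hU, encard_biUnion_finset F _ hdis, orderingCount_eq_sum G _ hne, Nat.cast_sum]
    refine Finset.sum_congr rfl fun x hx => ?_
    obtain ⟨hx0, y, hy0, hy⟩ := hmem x hx
    have hA' : (Finset.univ.filter fun z => Function.update ℓ x (i + 1) z = 0) = A.erase x := by
      ext z
      by_cases hz : z = x <;> simp [hz, hA, Function.update_apply]
    have hS' : {z | Function.update ℓ x (i + 1) z ≠ 0} = insert x {z | ℓ z ≠ 0} := by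
      ext z
      by_cases hz : z = x <;> simp [hz, Function.update_apply]
    have hxA : x ∈ A := (Finset.mem_filter.1 hx).1
    rw [ih (i + 1) _ (h.update hy0 hy hx0) (by omega)
      (by rw [hA', Finset.card_erase_of_mem hxA]; omega), hA', hS']

theorem encard_labelingsFrom (G : SimpleGraph V) (v : V) :
    {ℓ : V → ℕ | IsRandomWalkLabeling G ℓ ∧ ℓ v = 1}.encard =
      orderingCount G {v} (Finset.univ.erase v) := by
  have : Nonempty V := ⟨v⟩
  have hc := completions_encard G 1 _ (isGrowthLabeling_single G v) le_rfl
  have h1 : {x | Function.update (fun _ => 0) v 1 x ≠ 0} = {v} := by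
    ext z
    by_cases hz : z = v <;> simp [hz, Function.update_apply]
  have h2 : (Finset.univ.filter fun x => Function.update (fun _ => 0) v 1 x = 0) =
      Finset.univ.erase v := by
    ext z
    by_cases hz : z = v <;> simp [hz, Function.update_apply]
  rw [h1, h2] at hc
  rw [← hc]
  congr 1
  ext ℓ
  simp only [completions, Set.mem_ofPred_eq, isRandomWalkLabeling_iff]
  constructor
  · rintro ⟨⟨⟨N, hN⟩, h0⟩, hv⟩
    refine ⟨⟨N, hN⟩, h0, fun x => ?_⟩
    by_cases hx : x = v
    · simp [hx, hv]
    · have h1 : ℓ x ≠ 1 := fun h => hx (hN.inj x v (h0 x) (h.trans hv.symm))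
      have := h0 x
      rw [Function.update_of_ne hx]
      exact ⟨fun h => absurd rfl h, fun _ => by omega⟩
  · rintro ⟨hN, h0, h'⟩
    exact ⟨⟨hN, h0⟩, by simpa using (h' v).1 (by simp)⟩

theorem numLabelingsFrom_eq (G : SimpleGraph V) (v : V) :
    numLabelingsFrom G v = orderingCount G {v} (Finset.univ.erase v) := by
  rw [numLabelingsFrom, Set.ncard, encard_labelingsFrom, ENat.toNat_natCast]

theorem numLabelings_eq_sum [Nonempty V] (G : SimpleGraph V) :
    numLabelings G = ∑ v, orderingCount G {v} (Finset.univ.erase v) := by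
  have hU : {ℓ : V → ℕ | IsRandomWalkLabeling G ℓ} =
      ⋃ v ∈ Finset.univ, {ℓ | IsRandomWalkLabeling G ℓ ∧ ℓ v = 1} := by
    ext ℓ
    simp only [Set.mem_ofPred_eq, Finset.mem_univ, Set.iUnion_true, Set.mem_iUnion, exists_and_left]
    refine ⟨fun h => ⟨h, ?_⟩, fun h => h.1⟩
    obtain ⟨⟨i, hi⟩, h0⟩ := (isRandomWalkLabeling_iff G ℓ).1 h
    obtain ⟨x⟩ := ‹Nonempty V›
    have h1 := hi.le x
    have h2 := h0 x
    exact hi.surj 1 le_rfl (by omega)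
  have hdis : ((Finset.univ : Finset V) : Set V).PairwiseDisjoint
      fun v => {ℓ : V → ℕ | IsRandomWalkLabeling G ℓ ∧ ℓ v = 1} := by
    intro x _ y _ hxy
    refine Set.disjoint_left.2 fun ℓ ⟨h, hx⟩ ⟨_, hy⟩ => hxy ?_
    obtain ⟨⟨i, hi⟩, h0⟩ := (isRandomWalkLabeling_iff G ℓ).1 h
    exact hi.inj x y (h0 x) (hx.trans hy.symm)
  rw [numLabelings, Set.ncard, hU, encard_biUnion_finset _ _ hdis]
  simp only [encard_labelingsFrom]
  rw [← Nat.cast_sum, ENat.toNat_natCast]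

end Labelings

/-! ### The infinite snake graph -/

section Snake

/-- The two-way infinite snake graph on `ℤ`: consecutive integers are adjacent, and so are
consecutive multiples of `t`, so that every interval `[k * t, (k + 1) * t]` spans a cycle of length
`t + 1` if `2 ≤ t`. The snake graph with `n` cycles is induced on `[0, n * t]`. -/
def infiniteSnake (t : ℕ) : SimpleGraph ℤ where
  Adj u v := u ≠ v ∧ (|u - v| = 1 ∨ |u - v| = t ∧ (t : ℤ) ∣ u)
  symm := ⟨by
    rintro u v ⟨hne, h⟩
    rw [abs_sub_comm u v] at h
    refine ⟨hne.symm, h.imp id fun ⟨h, hu⟩ => ⟨h, ?_⟩⟩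
    have : (t : ℤ) ∣ v - u := by rw [← dvd_abs, h]
    exact (dvd_sub_left hu).1 this⟩
  loopless := ⟨fun _ h => h.1 rfl⟩

variable {t : ℕ}

theorem infiniteSnake_adj (ht : 2 ≤ t) {u v : ℤ} : (infiniteSnake t).Adj u v ↔
    u = v + 1 ∨ v = u + 1 ∨ u = v + t ∧ (t : ℤ) ∣ u ∨ v = u + t ∧ (t : ℤ) ∣ u := by
  simp only [infiniteSnake, ne_eq]
  rcases abs_cases (u - v) with h | h <;> rw [h.1] <;> omega

theorem infiniteSnake_adj_add (ht : 2 ≤ t) {c : ℤ} (hc : (t : ℤ) ∣ c) (u v : ℤ) :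
    (infiniteSnake t).Adj u v ↔ (infiniteSnake t).Adj (c + u) (c + v) := by
  rw [infiniteSnake_adj ht, infiniteSnake_adj ht, Int.dvd_add_right hc]
  omega

theorem infiniteSnake_adj_sub (ht : 2 ≤ t) {c : ℤ} (hc : (t : ℤ) ∣ c) (u v : ℤ) :
    (infiniteSnake t).Adj u v ↔ (infiniteSnake t).Adj (c - u) (c - v) := by
  rw [SimpleGraph.adj_comm, infiniteSnake_adj ht, infiniteSnake_adj ht, dvd_sub_right hc]
  have h1 : v = u + t → ((t : ℤ) ∣ v ↔ (t : ℤ) ∣ u) := by rintro rfl; simp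
  have h2 : u = v + t → ((t : ℤ) ∣ v ↔ (t : ℤ) ∣ u) := by rintro rfl; simp
  constructor
  · rintro (h | h | ⟨h, h'⟩ | ⟨h, h'⟩)
    · omega
    · omega
    · exact Or.inr (Or.inr (Or.inl ⟨by omega, (h1 h).1 h'⟩))
    · exact Or.inr (Or.inr (Or.inr ⟨by omega, (h2 h).1 h'⟩))
  · rintro (h | h | ⟨h, h'⟩ | ⟨h, h'⟩)
    · omega
    · omega
    · exact Or.inr (Or.inr (Or.inl ⟨by omega, (h1 (by omega)).2 h'⟩))
    · exact Or.inr (Or.inr (Or.inr ⟨by omega, (h2 (by omega)).2 h'⟩))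

theorem add_le_of_dvd_of_lt {a b c : ℤ} (ha : a ∣ b) (hc : a ∣ c) (h : b < c) : b + a ≤ c := by
  have := Int.le_of_dvd (by omega) (dvd_sub hc ha)
  omega

/-- A multiple of `t` separates the infinite snake graph. -/
theorem infiniteSnake_not_adj (ht : 2 ≤ t) {c x y : ℤ} (hc : (t : ℤ) ∣ c) (hy : y < c)
    (hx : c < x) : ¬ (infiniteSnake t).Adj y x := by
  rw [infiniteSnake_adj ht]
  rintro (h | h | ⟨h, h'⟩ | ⟨h, h'⟩)
  · omega
  · omega
  · omega
  · have := add_le_of_dvd_of_lt h' hc hy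
    omega

/-- The vertices of the first cycle other than `0` and `t` have degree two. -/
theorem infiniteSnake_adj_interior (ht : 2 ≤ t) {x y : ℤ} (h0 : 0 < x) (hx : x < t) :
    (infiniteSnake t).Adj y x ↔ y = x - 1 ∨ y = x + 1 := by
  have hd : ¬ (t : ℤ) ∣ x := fun h => by have := Int.le_of_dvd h0 h; omega
  rw [infiniteSnake_adj ht]
  constructor
  · rintro (h | h | ⟨h, h'⟩ | ⟨h, h'⟩)
    · omega
    · omega
    · rw [h] at h'; simp at h'; exact absurd h' hd
    · exact absurd (h ▸ (dvd_add_self_right.2 h')) hd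
  · omega

theorem exists_adj_interior_iff (ht : 2 ≤ t) {S : Set ℤ} {x : ℤ} (h0 : 0 < x) (hx : x < t) :
    (∃ y ∈ S, (infiniteSnake t).Adj y x) ↔ x - 1 ∈ S ∨ x + 1 ∈ S := by
  simp [infiniteSnake_adj_interior ht h0 hx, and_or_left, exists_or]

/-- An arc of a cycle can be filled in from both of its ends, which leaves two choices for every
vertex but the last. -/
theorem orderingCount_arc (ht : 2 ≤ t) (n : ℕ) (S : Set ℤ) (a : ℤ) (h0 : 0 ≤ a)
    (hb : a + 2 + n ≤ t) (ha : a ∈ S) (hbS : a + 2 + n ∈ S)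
    (hS : ∀ x, a < x → x < a + 2 + n → x ∉ S) :
    orderingCount (infiniteSnake t) S (Finset.Ioo a (a + 2 + n)) = 2 ^ n := by
  induction n generalizing S a with
  | zero =>
    rw [orderingCount_of_unique _ _ (x := a + 1) (by simp)]
    · have : (Finset.Ioo a (a + 2 + (0 : ℕ))).erase (a + 1) = ∅ := by
        ext; simp; omega
      rw [this, orderingCount_empty, pow_zero]
    · intro z hz
      simp only [Finset.mem_Ioo] at hz
      have : z = a + 1 := by omega
      subst this
      rw [exists_adj_interior_iff ht (by omega) (by omega)]
      simp [ha]
  | succ n ih =>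
    push_cast at *
    rw [orderingCount_of_pair _ _ (x := a + 1) (x' := a + 2 + n) (by simp; omega)
      (by simp; omega) (by omega)]
    · have h1 : (Finset.Ioo a (a + 2 + (n + 1))).erase (a + 1) =
          Finset.Ioo (a + 1) (a + 1 + 2 + n) := by
        ext; simp; omega
      have h2 : (Finset.Ioo a (a + 2 + (n + 1))).erase (a + 2 + n) =
          Finset.Ioo a (a + 2 + n) := by
        ext; simp; omega
      rw [h1, h2, ih, ih, pow_succ, mul_two]
      · exact h0
      · omega
      · exact Set.mem_insert_of_mem _ ha
      · exact Set.mem_insert _ _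
      · intro x hx hx'
        rw [Set.mem_insert_iff, not_or]
        exact ⟨by omega, hS x hx (by omega)⟩
      · omega
      · omega
      · exact Set.mem_insert _ _
      · refine Set.mem_insert_of_mem _ ?_
        convert hbS using 1; ring
      · intro x hx hx'
        rw [Set.mem_insert_iff, not_or]
        exact ⟨by omega, hS x (by omega) (by omega)⟩
    · intro z hz
      simp only [Finset.mem_Ioo] at hz
      rw [exists_adj_interior_iff ht (by omega) (by omega)]
      constructor
      · rintro (h | h)
        · by_contra hne
          exact hS (z - 1) (by omega) (by omega) h
        · by_contra hne
          exact hS (z + 1) (by omega) (by omega) h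
      · rintro (rfl | rfl)
        · left; simpa using ha
        · right
          convert hbS using 1; ring

/-- The number of orderings of a snake with `N` cycles that start at an end of the path. -/
noncomputable def snakeEnd (t N : ℕ) : ℕ :=
  orderingCount (infiniteSnake t) {0} (Finset.Ioc 0 (N * t : ℤ))

/-- Once a multiple `c` of `t` is reached, what lies on its right is a snake of its own. -/
theorem orderingCount_right (ht : 2 ≤ t) (N : ℕ) (S : Set ℤ) {c : ℤ} (hc : (t : ℤ) ∣ c)
    (hcS : c ∈ S) (hS : ∀ y ∈ S, y ≤ c) :
    orderingCount (infiniteSnake t) S (Finset.Ioc c (c + N * t)) = snakeEnd t N := by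
  have him : Finset.Ioc c (c + N * t) = (Finset.Ioc 0 (N * t : ℤ)).image (c + ·) := by
    ext x
    simp only [Finset.mem_image, Finset.mem_Ioc]
    exact ⟨fun h => ⟨x - c, by omega⟩, by rintro ⟨y, hy, rfl⟩; omega⟩
  rw [snakeEnd, orderingCount_image _ (infiniteSnake t) (c + ·) {0} S _
    (fun _ _ _ _ h => add_left_cancel h), him]
  · intro x hx
    simp only [Finset.mem_Ioc] at hx
    simp only [Set.mem_singleton_iff, exists_eq_left]
    rw [infiniteSnake_adj_add ht hc, add_zero]
    refine ⟨fun h => ⟨c, hcS, h⟩, fun ⟨y, hy, h⟩ => ?_⟩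
    rcases (hS y hy).lt_or_eq with hlt | rfl
    · exact absurd h (infiniteSnake_not_adj ht hc hlt (by omega))
    · exact h
  · exact fun x _ y _ => infiniteSnake_adj_add ht hc x y

/-- The mirror image of `orderingCount_right`. -/
theorem orderingCount_left (ht : 2 ≤ t) (N : ℕ) (S : Set ℤ) {c : ℤ} (hc : (t : ℤ) ∣ c)
    (hcS : c ∈ S) (hS : ∀ y ∈ S, c ≤ y) :
    orderingCount (infiniteSnake t) S (Finset.Ico (c - N * t) c) = snakeEnd t N := by
  have him : Finset.Ico (c - N * t) c = (Finset.Ioc 0 (N * t : ℤ)).image (c - ·) := by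
    ext x
    simp only [Finset.mem_image, Finset.mem_Ioc, Finset.mem_Ico]
    exact ⟨fun h => ⟨c - x, by omega⟩, by rintro ⟨y, hy, rfl⟩; omega⟩
  rw [snakeEnd, orderingCount_image _ (infiniteSnake t) (c - ·) {0} S _
    (fun _ _ _ _ h => sub_right_injective h), him]
  · intro x hx
    simp only [Finset.mem_Ioc] at hx
    simp only [Set.mem_singleton_iff, exists_eq_left]
    rw [infiniteSnake_adj_sub ht hc, sub_zero]
    refine ⟨fun h => ⟨c, hcS, h⟩, fun ⟨y, hy, h⟩ => ?_⟩
    rcases (hS y hy).lt_or_eq with hlt | rfl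
    · exact absurd h.symm (infiniteSnake_not_adj ht hc (by omega) hlt)
    · exact h
  · exact fun x _ y _ => infiniteSnake_adj_sub ht hc x y

/-- The number of orderings of what is left of a snake when the first `t - d` vertices of its first
cycle have been visited: `d` vertices of the cycle, its exit `t`, and `N` further cycles. The
summand for `e` counts the orderings in which the exit comes when `e + 1` of the `d` vertices are
missing, and the summand `1` those in which it comes last. -/
noncomputable def snakeTail (t N d : ℕ) : ℕ :=
  snakeEnd t N * (1 + ∑ e ∈ Finset.range d, (e + 1 + N * t).choose (e + 1) * 2 ^ e)

theorem orderingCount_tail (ht : 2 ≤ t) (N d : ℕ) (S : Set ℤ) (hd : d + 1 ≤ t) (h0 : 0 ∈ S)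
    (hl : (t - d - 1 : ℤ) ∈ S) (hS : ∀ y ∈ S, y ≤ (t - d - 1 : ℤ)) :
    orderingCount (infiniteSnake t) S (Finset.Icc (t - d : ℤ) (t + N * t)) = snakeTail t N d := by
  have hNt : (0 : ℤ) ≤ N * t := by positivity
  -- the next vertex is that after the visited arc, or the exit `t`, which is adjacent to `0`
  have hcand : ∀ d : ℕ, ∀ S : Set ℤ, d + 1 ≤ t → 0 ∈ S → (t - d - 1 : ℤ) ∈ S →
      (∀ y ∈ S, y ≤ (t - d - 1 : ℤ)) → ∀ z ∈ Finset.Icc (t - d : ℤ) (t + N * t),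
      (∃ y ∈ S, (infiniteSnake t).Adj y z) ↔ z = t - d ∨ z = t := by
    intro d S hd h0 hl hS z hz
    simp only [Finset.mem_Icc] at hz
    constructor
    · rintro ⟨y, hy, h⟩
      have := hS y hy
      rcases (infiniteSnake_adj ht).1 h with h | h | ⟨h, h'⟩ | ⟨h, h'⟩
      · omega
      · omega
      · omega
      · rcases lt_trichotomy y 0 with hy0 | hy0 | hy0
        · have := add_le_of_dvd_of_lt h' (dvd_zero (t : ℤ)) hy0
          omega
        · omega
        · have := Int.le_of_dvd hy0 h'
          omega
    · rintro (rfl | rfl)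
      · exact ⟨_, hl, (infiniteSnake_adj ht).2 (by omega)⟩
      · exact ⟨0, h0, (infiniteSnake_adj ht).2 (by simp)⟩
  induction d generalizing S with
  | zero =>
    rw [orderingCount_of_unique _ _ (x := (t : ℤ)) (by simp; omega)
      (fun z hz => by simpa using hcand 0 S hd h0 hl hS z hz)]
    have : (Finset.Icc (t - (0 : ℕ) : ℤ) (t + N * t)).erase t = Finset.Ioc (t : ℤ) (t + N * t) := by
      ext; simp
    rw [this, orderingCount_right ht N _ dvd_rfl (Set.mem_insert _ _)]
    · simp [snakeTail]
    · rintro y (rfl | hy)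
      · rfl
      · have := hS y hy; omega
  | succ d ih =>
    have hcand := hcand (d + 1) S hd h0 hl hS
    push_cast at hl hS hcand ⊢
    rw [orderingCount_of_pair _ _ (by simp; omega) (by simp; omega) (by omega) hcand]
    have h1 : (Finset.Icc (t - (d + 1) : ℤ) (t + N * t)).erase (t - (d + 1)) =
        Finset.Icc (t - d : ℤ) (t + N * t) := by
      ext; simp; omega
    have h2 : (Finset.Icc (t - (d + 1) : ℤ) (t + N * t)).erase t =
        Finset.Ioo (t - d - 2 : ℤ) (t - d - 2 + 2 + d) ∪ Finset.Ioc (t : ℤ) (t + N * t) := by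
      ext; simp; omega
    rw [h1, h2, orderingCount_union, orderingCount_arc ht, orderingCount_right ht N _ dvd_rfl
      (Set.mem_insert _ _)]
    · have hc : (Finset.Ioo (t - d - 2 : ℤ) (t - d - 2 + 2 + d)).card = d + 1 := by
        rw [Int.card_Ioo]; omega
      have hc' : (Finset.Ioc (t : ℤ) (t + N * t)).card = N * t := by
        rw [Int.card_Ioc, add_sub_cancel_left]; exact_mod_cast Int.toNat_natCast _
      rw [ih, hc, hc', snakeTail, snakeTail, Finset.sum_range_succ]
      · ring
      · omega
      · exact Set.mem_insert_of_mem _ h0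
      · convert Set.mem_insert _ S using 1; ring
      · rintro y (rfl | hy)
        · omega
        · have := hS y hy; omega
    · rintro y (rfl | hy)
      · rfl
      · have := hS y hy; omega
    · omega
    · omega
    · refine Set.mem_insert_of_mem _ ?_
      convert hl using 1; ring
    · convert Set.mem_insert _ S using 1; ring
    · rintro x hx hx' (rfl | hxS)
      · omega
      · have := hS x hxS; omega
    · rw [Finset.disjoint_left]
      intro x hx hx'
      simp only [Finset.mem_Ioo, Finset.mem_Ioc] at hx hx'
      omega
    · intro x hx y hy
      simp only [Finset.mem_Ioo, Finset.mem_Ioc] at hx hy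
      exact infiniteSnake_not_adj ht dvd_rfl (by omega) (by omega)

end Snake

/-! ### Starting points on the path and inside a cycle -/

section Snake

variable {t : ℕ}

theorem card_Icc_tail (N d : ℕ) :
    (Finset.Icc (t - d : ℤ) (t + N * t)).card = d + 1 + N * t := by
  have hNt : (0 : ℤ) ≤ N * t := by positivity
  rw [Int.card_Icc]
  zify
  rw [Int.toNat_of_nonneg (by omega)]
  ring

theorem card_Ico_left (k : ℕ) {c : ℤ} : (Finset.Ico (c - k * t) c).card = k * t := by
  rw [Int.card_Ico, sub_sub_cancel]
  exact_mod_cast Int.toNat_natCast _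

@[simp]
theorem snakeEnd_zero : snakeEnd t 0 = 1 := by simp [snakeEnd]

theorem snakeEnd_succ (ht : 2 ≤ t) (N : ℕ) : snakeEnd t (N + 1) = snakeTail t N (t - 1) := by
  rw [← orderingCount_tail ht N (t - 1) {0} (by omega) rfl]
  · rw [snakeEnd]
    congr 1
    ext x
    simp only [Finset.mem_Ioc, Finset.mem_Icc]
    push_cast [Nat.cast_sub (show 1 ≤ t by omega)]
    rw [add_mul, one_mul, add_comm (t : ℤ)]
    omega
  · simp only [Set.mem_singleton_iff]; omega
  · rintro y rfl
    omega

/-- The snake with `k` cycles to the left and `l` cycles to the right of a vertex of the path,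
starting at that vertex: shuffle the orderings of the two halves. -/
theorem orderingCount_pathVertex (ht : 2 ≤ t) (k l : ℕ) :
    orderingCount (infiniteSnake t) {0} ((Finset.Icc (-(k * t) : ℤ) (l * t)).erase 0) =
      ((k + l) * t).choose (k * t) * snakeEnd t k * snakeEnd t l := by
  have hkt : (0 : ℤ) ≤ k * t := by positivity
  have hlt : (0 : ℤ) ≤ l * t := by positivity
  have hU : (Finset.Icc (-(k * t) : ℤ) (l * t)).erase 0 =
      Finset.Ico (0 - k * t : ℤ) 0 ∪ Finset.Ioc (0 : ℤ) (0 + l * t) := by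
    ext x
    simp only [Finset.mem_erase, Finset.mem_Icc, Finset.mem_union, Finset.mem_Ico, Finset.mem_Ioc]
    omega
  rw [hU, orderingCount_union, orderingCount_left ht k _ (dvd_zero _) (Set.mem_singleton _),
    orderingCount_right ht l _ (dvd_zero _) (Set.mem_singleton _), card_Ico_left]
  · rw [Int.card_Ioc, zero_add, sub_zero, add_mul]
    congr 4
  · rintro y rfl; rfl
  · rintro y rfl; rfl
  · rw [Finset.disjoint_left]
    intro x hx hx'
    simp only [Finset.mem_Ico, Finset.mem_Ioc] at hx hx'
    omega
  · intro x hx y hy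
    simp only [Finset.mem_Ico, Finset.mem_Ioc] at hx hy
    exact infiniteSnake_not_adj ht (dvd_zero _) hx.2 hy.1

/-- In the snake on `[-k * t, t + l * t]`, the number of orderings of the vertices that are left
when the arc `[a, b]` of the cycle on `[0, t]` has been visited. -/
noncomputable def arcCount (t k l a b : ℕ) : ℕ :=
  orderingCount (infiniteSnake t) (Set.Icc (a : ℤ) b)
    (Finset.Icc (-(k * t) : ℤ) (t + l * t) \ Finset.Icc (a : ℤ) b)

/-- An arc in the interior of the cycle is extended on one of its two sides. -/
theorem arcCount_eq_add (ht : 2 ≤ t) (k l : ℕ) {a b : ℕ} (hab : a ≤ b) (hb : b + 2 ≤ t) :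
    arcCount t k l (a + 1) (b + 1) = arcCount t k l a (b + 1) + arcCount t k l (a + 1) (b + 2) := by
  have hkt : (0 : ℤ) ≤ k * t := by positivity
  have hlt : (0 : ℤ) ≤ l * t := by positivity
  rw [arcCount, orderingCount_of_pair _ _ (x := (a : ℤ)) (x' := (b + 2 : ℤ)), arcCount, arcCount]
  · congr 2
    · ext x
      simp only [Set.mem_insert_iff, Set.mem_Icc]
      push_cast
      omega
    · ext x
      simp only [Finset.mem_erase, Finset.mem_sdiff, Finset.mem_Icc]
      push_cast
      omega
    · ext x
      simp only [Set.mem_insert_iff, Set.mem_Icc]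
      push_cast
      omega
    · ext x
      simp only [Finset.mem_erase, Finset.mem_sdiff, Finset.mem_Icc]
      push_cast
      omega
  · simp only [Finset.mem_sdiff, Finset.mem_Icc]
    push_cast
    omega
  · simp only [Finset.mem_sdiff, Finset.mem_Icc]
    push_cast
    omega
  · omega
  · intro z hz
    simp only [Finset.mem_sdiff, Finset.mem_Icc] at hz
    simp only [Set.mem_Icc]
    push_cast at hz ⊢
    constructor
    · rintro ⟨y, hy, h⟩
      rw [SimpleGraph.adj_comm, infiniteSnake_adj_interior ht (by omega) (by omega)] at h
      omega
    · rintro (rfl | rfl)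
      · exact ⟨a + 1, by omega, (infiniteSnake_adj ht).2 (by omega)⟩
      · exact ⟨b + 1, by omega, (infiniteSnake_adj ht).2 (by omega)⟩

/-- Once an arc contains the vertex `0` of the path, the snake on the left of `0` is visited
independently of the rest. -/
theorem arcCount_zero (ht : 2 ≤ t) (k l d : ℕ) (hd : d + 1 ≤ t) :
    arcCount t k l 0 (t - d - 1) =
      (k * t + (d + 1 + l * t)).choose (k * t) * snakeEnd t k * snakeTail t l d := by
  have hkt : (0 : ℤ) ≤ k * t := by positivity
  have hlt : (0 : ℤ) ≤ l * t := by positivity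
  have hcast : ((t - d - 1 : ℕ) : ℤ) = t - d - 1 := by omega
  have hU : Finset.Icc (-(k * t) : ℤ) (t + l * t) \ Finset.Icc ((0 : ℕ) : ℤ) (t - d - 1 : ℕ) =
      Finset.Ico (0 - k * t : ℤ) 0 ∪ Finset.Icc (t - d : ℤ) (t + l * t) := by
    ext x
    simp only [Finset.mem_sdiff, Finset.mem_Icc, Finset.mem_union, Finset.mem_Ico]
    omega
  rw [arcCount, hU, orderingCount_union, orderingCount_left ht k _ (dvd_zero _),
    orderingCount_tail ht l d _ hd, card_Ico_left, card_Icc_tail l d]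
  · simp only [Set.mem_Icc]; omega
  · simp only [Set.mem_Icc]; omega
  · simp only [Set.mem_Icc]; omega
  · simp only [Set.mem_Icc]; omega
  · simp only [Set.mem_Icc]; omega
  · rw [Finset.disjoint_left]
    intro x hx hx'
    simp only [Finset.mem_Ico, Finset.mem_Icc] at hx hx'
    omega
  · intro x hx y hy
    simp only [Finset.mem_Ico, Finset.mem_Icc] at hx hy
    exact infiniteSnake_not_adj ht (dvd_zero _) hx.2 (by omega)

theorem orderingCount_sub (ht : 2 ≤ t) (S : Set ℤ) (A : Finset ℤ) {c : ℤ} (hc : (t : ℤ) ∣ c) :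
    orderingCount (infiniteSnake t) S A =
      orderingCount (infiniteSnake t) ((c - ·) '' S) (A.image (c - ·)) := by
  refine orderingCount_image _ _ _ _ _ _ (fun _ _ _ _ h => sub_right_injective h) ?_
    fun x _ y _ => infiniteSnake_adj_sub ht hc x y
  intro x _
  simp [← infiniteSnake_adj_sub ht hc]

theorem orderingCount_add (ht : 2 ≤ t) (S : Set ℤ) (A : Finset ℤ) {c : ℤ} (hc : (t : ℤ) ∣ c) :
    orderingCount (infiniteSnake t) S A =
      orderingCount (infiniteSnake t) ((c + ·) '' S) (A.image (c + ·)) := by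
  refine orderingCount_image _ _ _ _ _ _ (fun _ _ _ _ h => add_left_cancel h) ?_
    fun x _ y _ => infiniteSnake_adj_add ht hc x y
  intro x _
  simp only [Set.exists_mem_image, ← infiniteSnake_adj_add ht hc]

theorem arcCount_reflect (ht : 2 ≤ t) (k l : ℕ) {a b : ℕ} (hab : a ≤ b) (hb : b ≤ t) :
    arcCount t k l a b = arcCount t l k (t - b) (t - a) := by
  rw [arcCount, orderingCount_sub ht _ _ (dvd_refl (t : ℤ)), arcCount]
  congr 1
  · ext x
    simp only [Set.mem_image, Set.mem_Icc]
    push_cast [Nat.cast_sub hb, Nat.cast_sub (hab.trans hb)]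
    exact ⟨by rintro ⟨y, hy, rfl⟩; omega, fun h => ⟨t - x, by omega⟩⟩
  · ext x
    simp only [Finset.mem_image, Finset.mem_sdiff, Finset.mem_Icc]
    push_cast [Nat.cast_sub hb, Nat.cast_sub (hab.trans hb)]
    exact ⟨by rintro ⟨y, hy, rfl⟩; omega, fun h => ⟨t - x, by omega⟩⟩

/-- Summing over all starting points an arc that grows inside `[1, t - 1]` until it reaches `0` or
`t`. An arc of length `e + 1` that ends at `1` (or `t - 1`) arises from its `e + 1` possible starting
points in `2 ^ e` ways altogether. -/
theorem sum_diagonal (f : ℕ → ℕ → ℕ)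
    (hf : ∀ a b, a ≤ b → b + 2 ≤ t → f (a + 1) (b + 1) = f a (b + 1) + f (a + 1) (b + 2)) :
    ∑ a ∈ Finset.range (t - 1), f (a + 1) (a + 1) =
      ∑ e ∈ Finset.range (t - 1), 2 ^ e * (f 0 (e + 1) + f (t - 1 - e) t) := by
  have key : ∀ L, L + 1 ≤ t → ∑ a ∈ Finset.range (t - 1), f (a + 1) (a + 1) =
      (∑ e ∈ Finset.range L, 2 ^ e * (f 0 (e + 1) + f (t - 1 - e) t)) +
        2 ^ L * ∑ a ∈ Finset.range (t - 1 - L), f (a + 1) (a + 1 + L) := by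
    intro L
    induction L with
    | zero => simp
    | succ L ih =>
      intro hL
      obtain ⟨p, hp⟩ : ∃ p, t = p + 2 + L := ⟨t - 2 - L, by omega⟩
      rw [ih (by omega), Finset.sum_range_succ, add_assoc]
      congr 1
      have h1 : t - 1 - L = p + 1 := by omega
      have h2 : t - 1 - (L + 1) = p := by omega
      have hs : ∑ a ∈ Finset.range (p + 1), f (a + 1) (a + 1 + L) =
          ∑ a ∈ Finset.range (p + 1), f a (a + L + 1) +
            ∑ a ∈ Finset.range (p + 1), f (a + 1) (a + L + 2) := by
        rw [← Finset.sum_add_distrib]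
        refine Finset.sum_congr rfl fun a ha => ?_
        have := Finset.mem_range.1 ha
        rw [← hf a (a + L) (by omega) (by omega)]
        congr 1; omega
      rw [h1, h2, hs, Finset.sum_range_succ', Finset.sum_range_succ (fun a => f (a + 1) (a + L + 2)),
        show p + L + 2 = t by omega, zero_add, pow_succ,
        Finset.sum_congr rfl fun a _ => show f (a + 1) (a + 1 + L + 1) = f (a + 1) (a + L + 2) by
          congr 1; omega,
        Finset.sum_congr rfl fun a _ => show f (a + 1) (a + 1 + (L + 1)) = f (a + 1) (a + L + 2) by
          congr 1; omega]
      ring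
  rcases Nat.eq_zero_or_pos t with rfl | ht
  · simp
  · simpa using key (t - 1) (by omega)

/-- The number of orderings of a snake that start in the interior of a given cycle. -/
theorem sum_arcCount (ht : 2 ≤ t) (k l : ℕ) :
    ∑ a ∈ Finset.range (t - 1), arcCount t k l (a + 1) (a + 1) =
      ∑ e ∈ Finset.range (t - 1), 2 ^ e * (arcCount t k l 0 (e + 1) + arcCount t l k 0 (e + 1)) := by
  rw [sum_diagonal (arcCount t k l) fun a b hab hb => arcCount_eq_add ht k l hab hb]
  refine Finset.sum_congr rfl fun e he => ?_
  have := Finset.mem_range.1 he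
  rw [arcCount_reflect ht k l (show t - 1 - e ≤ t by omega) le_rfl, Nat.sub_self,
    show t - (t - 1 - e) = e + 1 by omega]

end Snake

/-! ### The finite snake graphs -/

section Bridge

/-- Sorting the vertices of the snake graph on `[0, n * t]` into the vertices of the path and the
interiors of the cycles. -/
theorem sum_snake_vertices (n t : ℕ) (ht : 1 ≤ t) (g : ℕ → ℕ) :
    ∑ v ∈ Finset.range (n * t + 1), g v =
      ∑ k ∈ Finset.range n, ∑ a ∈ Finset.range (t - 1), g (k * t + (a + 1)) +
        ∑ k ∈ Finset.range (n + 1), g (k * t) := by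
  induction n with
  | zero => simp
  | succ n ih =>
    rw [show (n + 1) * t + 1 = n * t + 1 + (t - 1 + 1) by rw [add_mul]; omega,
      Finset.sum_range_add, ih, Finset.sum_range_succ _ (t - 1), Finset.sum_range_succ _ n,
      Finset.sum_range_succ _ (n + 1), show n * t + 1 + (t - 1) = (n + 1) * t by
        rw [add_mul]; omega]
    simp only [add_assoc, add_comm 1]
    rw [Finset.sum_range_succ _ n, Finset.sum_range_succ (fun k => g (k * t)) n]
    abel

theorem orderingCount_translate_path {t : ℕ} (ht : 2 ≤ t) {k n : ℕ} (hk : k ≤ n) :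
    orderingCount (infiniteSnake t) {((k * t : ℕ) : ℤ)}
        ((Finset.Icc 0 (n * t : ℤ)).erase (k * t : ℕ)) =
      (n * t).choose (k * t) * snakeEnd t k * snakeEnd t (n - k) := by
  obtain ⟨l, rfl⟩ := Nat.exists_eq_add_of_le hk
  rw [Nat.add_sub_cancel_left, ← orderingCount_pathVertex ht,
    orderingCount_add ht {0} _ (dvd_mul_left (t : ℤ) k)]
  push_cast
  rw [add_mul, Set.image_singleton, add_zero]
  congr 1
  ext x
  simp only [Finset.mem_image, Finset.mem_erase, Finset.mem_Icc]
  exact ⟨fun h => ⟨x - k * t, by omega⟩, by rintro ⟨y, hy, rfl⟩; omega⟩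

theorem orderingCount_translate_interior {t : ℕ} (ht : 2 ≤ t) {k n : ℕ} (hk : k < n) (a : ℕ) :
    orderingCount (infiniteSnake t) {((k * t + a : ℕ) : ℤ)}
        ((Finset.Icc 0 (n * t : ℤ)).erase (k * t + a : ℕ)) =
      arcCount t k (n - 1 - k) a a := by
  obtain ⟨l, rfl⟩ := Nat.exists_eq_add_of_lt hk
  rw [show k + l + 1 - 1 - k = l by omega, arcCount,
    orderingCount_add ht (Set.Icc (a : ℤ) a) _ (dvd_mul_left (t : ℤ) k)]
  push_cast
  rw [add_mul, add_mul, one_mul, Set.Icc_self, Set.image_singleton]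
  congr 1
  ext x
  simp only [Finset.mem_image, Finset.mem_erase, Finset.mem_sdiff, Finset.mem_Icc]
  exact ⟨fun h => ⟨x - k * t, by omega⟩, by rintro ⟨y, hy, rfl⟩; omega⟩

theorem cycleGraph_adj_iff_val {m : ℕ} (hm : 3 ≤ m) (a b : Fin m) :
    (SimpleGraph.cycleGraph m).Adj a b ↔ (a : ℕ) = b + 1 ∨ (b : ℕ) = a + 1 ∨
      (a : ℕ) = 0 ∧ (b : ℕ) = m - 1 ∨ (b : ℕ) = 0 ∧ (a : ℕ) = m - 1 := by
  have key : ∀ a b : Fin m, ((a - b : Fin m) : ℕ) = 1 ↔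
      (a : ℕ) = b + 1 ∨ (a : ℕ) = 0 ∧ (b : ℕ) = m - 1 := by
    intro a b
    rcases le_or_gt b a with h | h
    · rw [Fin.coe_sub_iff_le.2 h]
      have := Fin.le_def.1 h
      omega
    · rw [Fin.coe_sub_iff_lt.2 h]
      have := Fin.lt_def.1 h
      omega
  rw [SimpleGraph.cycleGraph_adj', key, key]
  tauto

theorem exists_cycleGraph_adj_iff {t n : ℕ} (ht : 2 ≤ t) {u v : ℕ} (hu : u < n * t + 1)
    (hv : v < n * t + 1) :
    (∃ k < n, ∃ a b : Fin (t + 1), (SimpleGraph.cycleGraph (t + 1)).Adj a b ∧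
      u = k * t + a ∧ v = k * t + b) ↔ (infiniteSnake t).Adj (u : ℤ) (v : ℤ) := by
  simp only [cycleGraph_adj_iff_val (show 3 ≤ t + 1 by omega), Nat.add_sub_cancel]
  rw [infiniteSnake_adj ht]
  have hdm : ∀ x : ℕ, x / t * t + x % t = x := fun x => Nat.div_add_mod' x t
  have hml : ∀ x : ℕ, x % t < t := fun x => Nat.mod_lt x (by omega)
  have hdl : ∀ x : ℕ, x < n * t → x / t < n := fun x hx => Nat.div_lt_of_lt_mul (by rwa [mul_comm])
  constructor
  · rintro ⟨k, hk, a, b, h, hu, hv⟩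
    rw [hu, hv]
    have hd : (t : ℤ) ∣ k * t := dvd_mul_left _ _
    rcases h with h | h | ⟨h, h'⟩ | ⟨h, h'⟩
    · rw [h]; push_cast; left; ring
    · rw [h]; push_cast; right; left; ring
    · rw [h, h']; right; right; right; push_cast; exact ⟨by ring, by simp⟩
    · rw [h, h']; right; right; left; push_cast; exact ⟨by ring, by simp⟩
  · rintro (h | h | ⟨h, h'⟩ | ⟨h, h'⟩)
    · have := hdm v
      have := hml v
      refine ⟨v / t, hdl v (by omega), ⟨v % t + 1, by omega⟩, ⟨v % t, by omega⟩, ?_, ?_, ?_⟩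
      · simp
      all_goals simp only []; omega
    · have := hdm u
      have := hml u
      refine ⟨u / t, hdl u (by omega), ⟨u % t, by omega⟩, ⟨u % t + 1, by omega⟩, ?_, ?_, ?_⟩
      · simp
      all_goals simp only []; omega
    · have hd : t ∣ v := by
        rw [h, dvd_add_self_right] at h'
        exact_mod_cast h'
      obtain ⟨k, hk⟩ := hd
      rw [mul_comm] at hk
      refine ⟨k, ?_, ⟨t, by omega⟩, ⟨0, by omega⟩, by simp, ?_, by simpa using hk⟩
      · have : (k + 1) * t ≤ n * t := by rw [add_mul]; omega
        exact Nat.le_of_mul_le_mul_right this (by omega)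
      · simp only []; omega
    · obtain ⟨k, hk⟩ : t ∣ u := by exact_mod_cast h'
      rw [mul_comm] at hk
      refine ⟨k, ?_, ⟨0, by omega⟩, ⟨t, by omega⟩, by simp, by simpa using hk, ?_⟩
      · have : (k + 1) * t ≤ n * t := by rw [add_mul]; omega
        exact Nat.le_of_mul_le_mul_right this (by omega)
      · simp only []; omega

theorem snakeGraph_adj_iff {m : ℕ} (hm : 3 ≤ m) {n : ℕ} (u v : Fin (n * (m - 1) + 1)) :
    (snakeGraph m n).Adj u v ↔ (infiniteSnake (m - 1)).Adj (u : ℕ) (v : ℕ) := by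
  obtain ⟨t, rfl⟩ : ∃ t, m = t + 1 := ⟨m - 1, by omega⟩
  exact exists_cycleGraph_adj_iff (by omega) u.2 v.2

theorem orderingCount_snakeGraph {m : ℕ} (hm : 3 ≤ m) {n : ℕ} (v : Fin (n * (m - 1) + 1)) :
    orderingCount (snakeGraph m n) {v} (Finset.univ.erase v) =
      orderingCount (infiniteSnake (m - 1)) {((v : ℕ) : ℤ)}
        ((Finset.Icc 0 (n * (m - 1 : ℕ) : ℤ)).erase (v : ℕ)) := by
  rw [orderingCount_image (snakeGraph m n) (infiniteSnake (m - 1)) (fun x => ((x : ℕ) : ℤ)) {v}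
    {((v : ℕ) : ℤ)}]
  · congr 1
    ext x
    simp only [Finset.mem_image, Finset.mem_erase, Finset.mem_univ, and_true, Finset.mem_Icc]
    constructor
    · rintro ⟨y, hy, rfl⟩
      have := y.2
      have : (y : ℕ) ≠ v := fun h => hy (Fin.ext h)
      refine ⟨by omega, by omega, ?_⟩
      exact_mod_cast Nat.le_of_lt_succ y.2
    · rintro ⟨hxv, hx0, hxn⟩
      lift x to ℕ using hx0
      have hx : x < n * (m - 1) + 1 := Nat.lt_succ_of_le (by exact_mod_cast hxn)
      exact ⟨⟨x, hx⟩, fun h => hxv (by rw [← h]), rfl⟩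
  · intro x _ y _ h
    exact Fin.ext (Nat.cast_injective h)
  · intro x _
    simp [snakeGraph_adj_iff hm]
  · exact fun x _ y _ => snakeGraph_adj_iff hm x y

theorem endLabelings_eq {m : ℕ} (hm : 3 ≤ m) (n : ℕ) :
    endLabelings m n = snakeEnd (m - 1) n := by
  rw [endLabelings, numLabelingsFrom_eq, orderingCount_snakeGraph hm, snakeEnd]
  congr 1
  ext x
  simp only [Finset.mem_erase, Finset.mem_Icc, Finset.mem_Ioc, Fin.val_zero, Nat.cast_zero]
  omega

theorem numLabelingsFrom_last {m : ℕ} (hm : 3 ≤ m) (n : ℕ) :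
    numLabelingsFrom (snakeGraph m n) (Fin.last (n * (m - 1))) = snakeEnd (m - 1) n := by
  have := orderingCount_translate_path (t := m - 1) (by omega) (le_refl n)
  rw [numLabelingsFrom_eq, orderingCount_snakeGraph hm, Fin.val_last, this]
  simp

theorem numLabelings_snakeGraph {m : ℕ} (hm : 3 ≤ m) (n : ℕ) :
    numLabelings (snakeGraph m n) =
      ∑ k ∈ Finset.range n, ∑ a ∈ Finset.range (m - 1 - 1),
          arcCount (m - 1) k (n - 1 - k) (a + 1) (a + 1) +
        ∑ k ∈ Finset.range (n + 1), (n * (m - 1)).choose (k * (m - 1)) *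
          snakeEnd (m - 1) k * snakeEnd (m - 1) (n - k) := by
  rw [numLabelings_eq_sum]
  simp only [orderingCount_snakeGraph hm]
  rw [Fin.sum_univ_eq_sum_range (fun v => orderingCount (infiniteSnake (m - 1)) {(v : ℤ)}
    ((Finset.Icc 0 (n * (m - 1 : ℕ) : ℤ)).erase v)), sum_snake_vertices n (m - 1) (by omega)]
  congr 1
  · refine Finset.sum_congr rfl fun k hk => Finset.sum_congr rfl fun a _ => ?_
    exact orderingCount_translate_interior (by omega) (Finset.mem_range.1 hk) _
  · refine Finset.sum_congr rfl fun k hk => ?_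
    exact orderingCount_translate_path (by omega) (Nat.le_of_lt_succ (Finset.mem_range.1 hk))

end Bridge

/-! ### Binomial sums -/

/-- Comparing coefficients in `(1 - X) ^ (-(r + 1)) * (1 - X) ^ (-(w + 1)) =
(1 - X) ^ (-(r + w + 2))`; the proof uses Pascal's rule. -/
theorem sum_choose_mul_choose (q r w : ℕ) :
    ∑ s ∈ Finset.range (q + 1), (r + s).choose s * (q - s + w).choose (q - s) =
      (q + r + w + 1).choose q := by
  induction r generalizing q with
  | zero =>
    rw [← Finset.sum_range_reflect]
    have : ∀ s ∈ Finset.range (q + 1), (0 + (q + 1 - 1 - s)).choose (q + 1 - 1 - s) *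
        (q - (q + 1 - 1 - s) + w).choose (q - (q + 1 - 1 - s)) = (s + w).choose s := by
      intro s hs
      have := Finset.mem_range.1 hs
      rw [zero_add, Nat.choose_self, one_mul, show q - (q + 1 - 1 - s) = s by omega]
    rw [Finset.sum_congr rfl this, add_zero]
    clear this
    induction q with
    | zero => simp
    | succ q ih =>
      rw [Finset.sum_range_succ, ih, show q + 1 + w + 1 = q + w + 1 + 1 by ring,
        Nat.choose_succ_succ, show q + 1 + w = q + w + 1 by ring]
  | succ r ihr =>
    induction q with
    | zero => simp
    | succ q ihq =>
      have h := ihr (q + 1)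
      rw [Finset.sum_range_succ'] at h ⊢
      simp only [Nat.add_sub_add_right] at h ⊢
      have hp : ∀ s, (r + 1 + (s + 1)).choose (s + 1) =
          (r + 1 + s).choose s + (r + (s + 1)).choose (s + 1) := by
        intro s
        rw [← add_assoc, Nat.choose_succ_succ, show r + (s + 1) = r + 1 + s by ring]
      simp only [hp, add_mul, Finset.sum_add_distrib, ihq]
      rw [show q + 1 + (r + 1) + w + 1 = q + (r + 1) + w + 1 + 1 by ring, Nat.choose_succ_succ,
        show q + (r + 1) + w + 1 = q + 1 + r + w + 1 by ring, ← h]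
      simp [add_assoc]

theorem multinomial_three_eq (a b c : ℕ) :
    Nat.multinomial Finset.univ ![a, b, c] = (b + c).choose b * (a + (b + c)).choose a := by
  have h1 := Nat.add_choose_mul_factorial_mul_factorial b c
  have h2 := Nat.add_choose_mul_factorial_mul_factorial a (b + c)
  have h := Nat.multinomial_spec Finset.univ ![a, b, c]
  simp only [Fin.prod_univ_three, Fin.sum_univ_three, Matrix.cons_val] at h
  have hpos : 0 < a.factorial * b.factorial * c.factorial := by positivity
  apply Nat.eq_of_mul_eq_mul_left hpos
  rw [h, add_assoc, ← h2, ← h1, Nat.choose_symm_add (a := b), Nat.choose_symm_add (a := a)]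
  ring

theorem sum_Icc_two (t : ℕ) (f : ℕ → ℕ) :
    ∑ j ∈ Finset.Icc 2 t, f j = ∑ e ∈ Finset.range (t - 1), f (e + 2) := by
  refine Finset.sum_nbij' (· - 2) (· + 2) ?_ ?_ ?_ ?_ ?_ <;>
    simp only [Finset.mem_Icc, Finset.mem_range]
  · omega
  · omega
  · omega
  · omega
  · intro j hj; congr 1; omega

/-- Twice the number of orderings, over all starting points in a given cycle, that reach the left
exit of the cycle first and have visited `j` vertices at that moment: there are `2 ^ (j - 2)` ways to
fill the arc `[0, j - 1]` with `0` last. On the right, `r` is the number of vertices of the cycle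
visited between the two exits and `s` the number of vertices of the left snake visited in that time;
the second sum is the case in which the right exit is the last vertex of the cycle. The sum over `s`
is evaluated by `sum_choose_mul_choose`. -/
theorem arcCount_zero_eq {t : ℕ} (k l j : ℕ) (ht : 2 ≤ t) (hj : 2 ≤ j) (hjt : j ≤ t) :
    2 ^ (j - 1) * arcCount t k l 0 (j - 1) =
      ∑ r ∈ Finset.range (t - j), ∑ s ∈ Finset.range (k * t + 1),
          (r + s).choose s * Nat.multinomial Finset.univ ![k * t - s, t - j - r, l * t] *
            2 ^ (t - r - 2) * snakeEnd t k * snakeEnd t l +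
        2 ^ (j - 1) * ∑ s ∈ Finset.range (k * t + 1),
          (t - j + s).choose s * ((k + l) * t - s).choose (k * t - s) *
            snakeEnd t k * snakeEnd t l := by
  obtain ⟨d, hd⟩ : ∃ d, t - j = d := ⟨_, rfl⟩
  have hA := arcCount_zero ht k l d (by omega)
  rw [show t - d - 1 = j - 1 by omega] at hA
  have h1 : ∀ r ∈ Finset.range d, ∑ s ∈ Finset.range (k * t + 1),
      (r + s).choose s * Nat.multinomial Finset.univ ![k * t - s, d - r, l * t] *
        2 ^ (t - r - 2) * snakeEnd t k * snakeEnd t l =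
      2 ^ (j - 1) * ((k * t + (d + 1 + l * t)).choose (k * t) * snakeEnd t k * (snakeEnd t l *
        ((d - 1 - r + 1 + l * t).choose (d - 1 - r + 1) * 2 ^ (d - 1 - r)))) := by
    intro r hr
    have hr := Finset.mem_range.1 hr
    rw [show t - r - 2 = j - 1 + (d - 1 - r) by omega, pow_add, show d - 1 - r + 1 = d - r by omega,
      show k * t + (d + 1 + l * t) = k * t + r + (d - r + l * t) + 1 by omega,
      ← sum_choose_mul_choose (k * t) r (d - r + l * t)]
    simp only [Finset.mul_sum, Finset.sum_mul]
    refine Finset.sum_congr rfl fun s _ => ?_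
    rw [multinomial_three_eq]
    ring
  have h2 : ∑ s ∈ Finset.range (k * t + 1), (d + s).choose s *
      ((k + l) * t - s).choose (k * t - s) * snakeEnd t k * snakeEnd t l =
      (k * t + (d + 1 + l * t)).choose (k * t) * snakeEnd t k * snakeEnd t l := by
    rw [show k * t + (d + 1 + l * t) = k * t + d + l * t + 1 by omega,
      ← sum_choose_mul_choose (k * t) d (l * t)]
    simp only [Finset.sum_mul]
    refine Finset.sum_congr rfl fun s hs => ?_
    have := Finset.mem_range.1 hs
    rw [show (k + l) * t - s = k * t - s + l * t by rw [add_mul]; omega]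
  rw [hd, Finset.sum_congr rfl h1, h2, hA, snakeTail, ← Finset.mul_sum, ← Finset.mul_sum,
    ← Finset.mul_sum, Finset.sum_range_reflect
      (fun e => (e + 1 + l * t).choose (e + 1) * 2 ^ e) d]
  ring

/-- Reflecting the snake exchanges the two exits of a cycle. -/
theorem sum_arcCount_eq {t : ℕ} (ht : 2 ≤ t) (n : ℕ) :
    ∑ k ∈ Finset.range n, ∑ a ∈ Finset.range (t - 1), arcCount t k (n - 1 - k) (a + 1) (a + 1) =
      ∑ k ∈ Finset.range n, ∑ j ∈ Finset.Icc 2 t, 2 ^ (j - 1) *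
        arcCount t k (n - 1 - k) 0 (j - 1) := by
  simp only [sum_arcCount ht, sum_Icc_two, mul_add, Finset.sum_add_distrib]
  have h : ∑ k ∈ Finset.range n, ∑ e ∈ Finset.range (t - 1),
      2 ^ e * arcCount t (n - 1 - k) k 0 (e + 1) =
      ∑ k ∈ Finset.range n, ∑ e ∈ Finset.range (t - 1),
        2 ^ e * arcCount t k (n - 1 - k) 0 (e + 1) := by
    rw [← Finset.sum_range_reflect]
    refine Finset.sum_congr rfl fun k hk => ?_
    have := Finset.mem_range.1 hk
    rw [show n - 1 - (n - 1 - k) = k by omega]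
  rw [h, ← two_mul]
  simp only [Finset.mul_sum]
  refine Finset.sum_congr rfl fun k _ => Finset.sum_congr rfl fun e _ => ?_
  rw [show e + 2 - 1 = e + 1 by omega, pow_succ]
  ring

theorem snakeEnd_recursion {t : ℕ} (ht : 2 ≤ t) (N : ℕ) :
    snakeEnd t (N + 1) = snakeEnd t N *
      (1 + ∑ j ∈ Finset.Icc 2 t, ((N + 1) * t + 1 - j).choose (t + 1 - j) * 2 ^ (t - j)) := by
  rw [snakeEnd_succ ht, snakeTail, sum_Icc_two, ← Finset.sum_range_reflect]
  congr 2
  refine Finset.sum_congr rfl fun e he => ?_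
  have := Finset.mem_range.1 he
  rw [show t - 1 - 1 - e + 1 + N * t = (N + 1) * t + 1 - (e + 2) by rw [add_mul]; omega,
    show t - 1 - 1 - e + 1 = t + 1 - (e + 2) by omega, show t - 1 - 1 - e = t - (e + 2) by omega]

theorem snakeEnd_one {t : ℕ} (ht : 2 ≤ t) : snakeEnd t 1 = 2 ^ (t - 1) := by
  rw [snakeEnd_succ ht 0, snakeTail, snakeEnd_zero]
  have := Nat.geomSum_eq (le_refl 2) (t - 1)
  simp only [zero_mul, add_zero, Nat.choose_self, one_mul]
  have := Nat.one_le_two_pow (n := t - 1)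
  omega

theorem theorem6 (m t : ℕ) (hm : 3 ≤ m) (ht : t = m - 1) :
    -- it does not matter at which of the two ends of the path the labelings start
    (∀ n : ℕ, numLabelingsFrom (snakeGraph m n) (Fin.last (n * (m - 1))) = endLabelings m n) ∧
    -- the recursion for the numbers `b_{m,n}`
    endLabelings m 0 = 1 ∧
    endLabelings m 1 = 2 ^ (m - 2) ∧
    (∀ n : ℕ, 1 < n → endLabelings m n =
      endLabelings m (n - 1) *
        (1 + ∑ j ∈ Finset.Icc 2 t, (n * t + 1 - j).choose (m - j) * 2 ^ (t - j))) ∧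
    -- the formula for `𝓛(S_{m,n})`; the upper entry of the multinomial coefficient is the sum
    -- `n * t - s - j - r` of the lower ones
    (∀ n : ℕ, numLabelings (snakeGraph m n) =
      (∑ k ∈ Finset.range n, ∑ j ∈ Finset.Icc 2 t, ∑ r ∈ Finset.range (t - j),
        ∑ s ∈ Finset.range (k * t + 1),
          (r + s).choose s *
            Nat.multinomial Finset.univ ![k * t - s, t - j - r, (n - 1 - k) * t] *
            2 ^ (t - r - 2) * endLabelings m k * endLabelings m (n - 1 - k)) +
      (∑ k ∈ Finset.range n, ∑ j ∈ Finset.Icc 2 t, 2 ^ (j - 1) *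
        ∑ s ∈ Finset.range (k * t + 1),
          (t - j + s).choose s * ((n - 1) * t - s).choose (k * t - s) *
            endLabelings m k * endLabelings m (n - 1 - k)) +
      ∑ k ∈ Finset.range (n + 1),
        (n * t).choose (k * t) * endLabelings m k * endLabelings m (n - k)) := by
  obtain ⟨t, rfl⟩ : ∃ u, m = u + 1 := ⟨t, by omega⟩
  rw [Nat.add_sub_cancel] at ht
  subst ht
  have ht : 2 ≤ t := by omega
  have hb : ∀ n, endLabelings (t + 1) n = snakeEnd t n := endLabelings_eq hm
  refine ⟨fun n => ?_, ?_, ?_, fun n hn => ?_, fun n => ?_⟩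
  · rw [numLabelingsFrom_last hm, endLabelings_eq hm]
  · rw [hb, snakeEnd_zero]
  · rw [hb, snakeEnd_one ht]
    rfl
  · obtain ⟨N, rfl⟩ := Nat.exists_eq_add_of_lt hn
    rw [hb, hb, snakeEnd_recursion ht]
    rfl
  · simp only [hb]
    rw [numLabelings_snakeGraph hm]
    simp only [Nat.add_sub_cancel]
    rw [sum_arcCount_eq ht, ← Finset.sum_add_distrib]
    congr 1
    refine Finset.sum_congr rfl fun k hk => ?_
    have hk := Finset.mem_range.1 hk
    rw [← Finset.sum_add_distrib]
    refine Finset.sum_congr rfl fun j hj => ?_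
    have hj := Finset.mem_Icc.1 hj
    rw [arcCount_zero_eq k (n - 1 - k) j ht hj.1 hj.2, show k + (n - 1 - k) = n - 1 by omega]
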